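/- Let $M$ parties hold finite-dimensional input systems $A_1,\dots,A_M$ and output systems $A_1',\dots,A_M'$, and let $\mathcal N_{A_1^M\to A_1'^M}$ be a quantum channel (completely positive and trace preserving), where $A_1^M=A_1\cdots A_M$, and similarly for the other systems. Let $\rho_{\hat A_1^M}$ be a quantum state of finite-dimensional systems $\hat A_1,\dots,\hat A_M$, party $i$ holding $\hat A_i$. For $S\subseteq\{1,\dots,M\}$ let $T_S$, $T_{\hat S}$, $T_{S'}$ be the partial transposes on the systems $A_i$, $\hat A_i$, $A_i'$ with $i\in S$ (products of these symbols in a subscript denote the joint partial transpose). A channel $\mathcal P_{A_1^M\hat A_1^M\to A_1'^M}$ is called completely PPT-preserving (C-PPT-P) if $T_{S'}\circ\mathcal P\circ T_{S\hat S}$ is completely positive for every $S\subseteq\{1,\dots,M\}$. It simulates $\mathcal N$ by $\widetilde{\mathcal N}^{\mathcal P}(\omega)=\mathcal P(\omega\otimes\rho_{\hat A_1^M})$. The channel fidelity is $$F(\mathcal N,\mathcal M)=\inf_{\sigma_{RC}}F\big((\mathrm{id}_R\otimes\mathcal N)(\sigma_{RC}),(\mathrm{id}_R\otimes\mathcal M)(\sigma_{RC})\big),\qquad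 F(\omega,\tau)=\|\sqrt\omega\sqrt\tau\|_1^2,$$ where $C=A_1^M$ is the joint input system and the infimum is over all finite-dimensional reference systems $R$ and all states $\sigma_{RC}$. The simulation error is $$e^F_{\mathrm{PPT}}(\mathcal N,\rho_{\hat A_1^M})=\inf_{\mathcal P\in\text{C-PPT-P}}\big(1-F(\mathcal N,\widetilde{\mathcal N}^{\mathcal P})\big).$$ Let $\Gamma^{\mathcal N}_{A_1^MA_1'^M}=(\mathrm{id}\otimes\mathcal N)(|\Gamma\rangle\langle\Gamma|)$ with $|\Gamma\rangle=\sum_i|i\rangle|i\rangle$ be the Choi operator of $\mathcal N$, and write $\operatorname{Re}[X]=\frac12(X+X^\dagger)$. Then $$e^F_{\mathrm{PPT}}(\mathcal N,\rho_{\hat A_1^M})=1-\Big[\sup\lambda\Big]^2,$$ where the supremum is over all real $\lambda\ge0$, all operators $P_{A_1^M\hat A_1^MA_1'^M}\ge0$ and all linear operators $Q_{A_1^MA_1'^M}$ subject to $$\lambda I_{A_1^M}\le\operatorname{Re}\big[\operatorname{Tr}_{A_1'^M}[Q_{A_1^MA_1'^M}]\big],\qquad \operatorname{Tr}_{A_1'^M}[P_{A_1^M\hat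 A_1^MA_1'^M}]=I_{A_1^M\hat A_1^M},$$ $$\begin{bmatrix}\Gamma^{\mathcal N}_{A_1^MA_1'^M}&Q^\dagger_{A_1^MA_1'^M}\\ Q_{A_1^MA_1'^M}&\operatorname{Tr}_{\hat A_1^M}[T_{\hat A_1^M}(\rho_{\hat A_1^M})P_{A_1^M\hat A_1^MA_1'^M}]\end{bmatrix}\ge0,$$ $$T_{S\hat SS'}(P_{A_1^M\hat A_1^MA_1'^M})\ge0\quad\text{for all }S\subseteq\{1,\dots,M\}.$$ Both the infimum and the supremum are over nonempty sets of real numbers, bounded below and above respectively. -/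

import Mathlib

open scoped ComplexOrder MatrixOrder Kronecker

namespace QSim

section Basics

variable {R C D : Type*}

/-- A quantum state (density matrix): positive semidefinite with unit trace. -/
def IsState [Fintype C] (ρ : Matrix C C ℂ) : Prop :=
  ρ.PosSemidef ∧ ρ.trace = 1

/-- The map `id_R ⊗ N`, acting blockwise on operators of the joint system `R C`. -/
def idTensor (R : Type*) (N : Matrix C C ℂ →ₗ[ℂ] Matrix D D ℂ)
    (X : Matrix (R × C) (R × C) ℂ) : Matrix (R × D) (R × D) ℂ :=
  Matrix.of fun x y => N (Matrix.of fun c c' => X (x.1, c) (y.1, c')) x.2 y.2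

/-- Complete positivity: `id_R ⊗ N` preserves positivity for every finite-dimensional `R`. -/
def IsCP (N : Matrix C C ℂ →ₗ[ℂ] Matrix D D ℂ) : Prop :=
  ∀ (n : ℕ) (X : Matrix (Fin n × C) (Fin n × C) ℂ),
    X.PosSemidef → (idTensor (Fin n) N X).PosSemidef

/-- A quantum channel: a completely positive and trace-preserving linear map. -/
def IsChannel [Fintype C] [Fintype D] (N : Matrix C C ℂ →ₗ[ℂ] Matrix D D ℂ) : Prop :=
  IsCP N ∧ ∀ X, (N X).trace = X.trace

/-- The vector `|Γ⟩ = ∑ i, |i⟩|i⟩`. -/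
def gammaVec (C : Type*) [DecidableEq C] : C × C → ℂ :=
  fun x => if x.1 = x.2 then 1 else 0

/-- The unnormalized maximally entangled operator `|Γ⟩⟨Γ|`. -/
def gammaOp (C : Type*) [DecidableEq C] : Matrix (C × C) (C × C) ℂ :=
  Matrix.vecMulVec (gammaVec C) (star (gammaVec C))

/-- The Choi operator `(id ⊗ N)(|Γ⟩⟨Γ|)`. -/
def choi [DecidableEq C] (N : Matrix C C ℂ →ₗ[ℂ] Matrix D D ℂ) :
    Matrix (C × D) (C × D) ℂ :=
  idTensor C N (gammaOp C)

/-- The partial trace over the second tensor factor. -/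
def traceSnd [Fintype D] (X : Matrix (C × D) (C × D) ℂ) : Matrix C C ℂ :=
  Matrix.of fun c c' => ∑ d, X (c, d) (c', d)

/-- The partial trace over the middle one of three tensor factors. -/
def traceMid [Fintype R] (X : Matrix ((C × R) × D) ((C × R) × D) ℂ) :
    Matrix (C × D) (C × D) ℂ :=
  Matrix.of fun x y => ∑ r, X ((x.1, r), x.2) ((y.1, r), y.2)

/-- The trace norm `Tr √(X† X)`. -/
noncomputable def traceNorm [Fintype C] [DecidableEq C] (X : Matrix C C ℂ) : ℝ :=
  (CFC.sqrt (X.conjTranspose * X)).trace.re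

/-- The Uhlmann fidelity `‖√ω √τ‖₁²` of two states. -/
noncomputable def fidelity [Fintype C] [DecidableEq C] (ω τ : Matrix C C ℂ) : ℝ :=
  traceNorm (CFC.sqrt ω * CFC.sqrt τ) ^ 2

/-- The channel fidelity: the infimum over all finite-dimensional reference systems `R` and all
states of `R C` of the fidelity of the two output states. -/
noncomputable def channelFidelity [Fintype C] [Fintype D] [DecidableEq D]
    (N N' : Matrix C C ℂ →ₗ[ℂ] Matrix D D ℂ) : ℝ :=
  sInf {f : ℝ | ∃ (n : ℕ) (ρ : Matrix (Fin n × C) (Fin n × C) ℂ), IsState ρ ∧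
    f = fidelity (idTensor (Fin n) N ρ) (idTensor (Fin n) N' ρ)}

/-- The channel `ω ↦ P (ω ⊗ ρ)` obtained from `P` and a resource state `ρ`. -/
def simulate (P : Matrix (C × R) (C × R) ℂ →ₗ[ℂ] Matrix D D ℂ) (ρ : Matrix R R ℂ) :
    Matrix C C ℂ →ₗ[ℂ] Matrix D D ℂ where
  toFun ω := P (ω ⊗ₖ ρ)
  map_add' ω ω' := by rw [Matrix.add_kronecker, map_add]
  map_smul' c ω := by rw [Matrix.smul_kronecker, map_smul, RingHom.id_apply]

end Basics

section Multipartite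

variable {ι : Type*} [DecidableEq ι] {A Ah A' : ι → Type*}

/-- The partial transpose `T_{S'}` on the systems `A' i`, `i ∈ S`, of a multipartite operator. -/
def transposeOut (S : Finset ι) :
    Matrix (∀ i, A' i) (∀ i, A' i) ℂ →ₗ[ℂ] Matrix (∀ i, A' i) (∀ i, A' i) ℂ where
  toFun X := Matrix.of fun x y => X (S.piecewise y x) (S.piecewise x y)
  map_add' _ _ := rfl
  map_smul' _ _ := rfl

/-- The partial transpose `T_{S Ŝ}` on the systems `A i` and `Ah i`, `i ∈ S`. -/
def transposeIn (S : Finset ι) :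
    Matrix ((∀ i, A i) × (∀ i, Ah i)) ((∀ i, A i) × (∀ i, Ah i)) ℂ →ₗ[ℂ]
      Matrix ((∀ i, A i) × (∀ i, Ah i)) ((∀ i, A i) × (∀ i, Ah i)) ℂ where
  toFun X := Matrix.of fun x y =>
    X (S.piecewise y.1 x.1, S.piecewise y.2 x.2) (S.piecewise x.1 y.1, S.piecewise x.2 y.2)
  map_add' _ _ := rfl
  map_smul' _ _ := rfl

/-- The partial transpose `T_{S Ŝ S'}` on the systems `A i`, `Ah i` and `A' i`, `i ∈ S`. -/
def transposeAll (S : Finset ι)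
    (X : Matrix (((∀ i, A i) × (∀ i, Ah i)) × (∀ i, A' i))
      (((∀ i, A i) × (∀ i, Ah i)) × (∀ i, A' i)) ℂ) :
    Matrix (((∀ i, A i) × (∀ i, Ah i)) × (∀ i, A' i))
      (((∀ i, A i) × (∀ i, Ah i)) × (∀ i, A' i)) ℂ :=
  Matrix.of fun x y =>
    X ((S.piecewise y.1.1 x.1.1, S.piecewise y.1.2 x.1.2), S.piecewise y.2 x.2)
      ((S.piecewise x.1.1 y.1.1, S.piecewise x.1.2 y.1.2), S.piecewise x.2 y.2)

variable [Fintype ι] [∀ i, Fintype (A i)] [∀ i, Fintype (Ah i)] [∀ i, Fintype (A' i)]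

/-- Completely PPT-preserving multipartite channels; party `i` holds the inputs `A i`, `Ah i` and
the output `A' i`. -/
def IsCPPTP (P : Matrix ((∀ i, A i) × (∀ i, Ah i)) ((∀ i, A i) × (∀ i, Ah i)) ℂ →ₗ[ℂ]
    Matrix (∀ i, A' i) (∀ i, A' i) ℂ) : Prop :=
  IsChannel P ∧ ∀ S : Finset ι, IsCP (transposeOut S ∘ₗ P ∘ₗ transposeIn S)

/-- The simulation errors `1 - F(N, Ñ)` achieved by the completely PPT-preserving channels. -/
def simErrors [∀ i, DecidableEq (A' i)]
    (N : Matrix (∀ i, A i) (∀ i, A i) ℂ →ₗ[ℂ] Matrix (∀ i, A' i) (∀ i, A' i) ℂ)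
    (ρ : Matrix (∀ i, Ah i) (∀ i, Ah i) ℂ) : Set ℝ :=
  {e : ℝ | ∃ P : Matrix ((∀ i, A i) × (∀ i, Ah i)) ((∀ i, A i) × (∀ i, Ah i)) ℂ →ₗ[ℂ]
      Matrix (∀ i, A' i) (∀ i, A' i) ℂ,
    IsCPPTP P ∧ e = 1 - channelFidelity N (simulate P ρ)}

/-- The infidelity simulation error minimized over all completely PPT-preserving channels. -/
noncomputable def simErrorPPT [∀ i, DecidableEq (A' i)]
    (N : Matrix (∀ i, A i) (∀ i, A i) ℂ →ₗ[ℂ] Matrix (∀ i, A' i) (∀ i, A' i) ℂ)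
    (ρ : Matrix (∀ i, Ah i) (∀ i, Ah i) ℂ) : ℝ :=
  sInf (simErrors N ρ)

variable [∀ i, DecidableEq (A i)] [∀ i, DecidableEq (Ah i)] [∀ i, DecidableEq (A' i)]

/-- The constraints of the semidefinite program on its variables `l`, `P`, `Q`. Here `realPart X`
is the Hermitian part `(X + X†) / 2`. -/
structure SDPFeasible
    (N : Matrix (∀ i, A i) (∀ i, A i) ℂ →ₗ[ℂ] Matrix (∀ i, A' i) (∀ i, A' i) ℂ)
    (ρ : Matrix (∀ i, Ah i) (∀ i, Ah i) ℂ) (l : ℝ)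
    (P : Matrix (((∀ i, A i) × (∀ i, Ah i)) × (∀ i, A' i))
      (((∀ i, A i) × (∀ i, Ah i)) × (∀ i, A' i)) ℂ)
    (Q : Matrix ((∀ i, A i) × (∀ i, A' i)) ((∀ i, A i) × (∀ i, A' i)) ℂ) : Prop where
  l_nonneg : 0 ≤ l
  P_nonneg : P.PosSemidef
  le_realPart : (l : ℂ) • (1 : Matrix (∀ i, A i) (∀ i, A i) ℂ) ≤
    (realPart (traceSnd Q) : Matrix (∀ i, A i) (∀ i, A i) ℂ)
  trace_P : traceSnd P = 1
  block_nonneg : (Matrix.fromBlocks (choi N) Q.conjTranspose Q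
    (traceMid ((((1 : Matrix (∀ i, A i) (∀ i, A i) ℂ) ⊗ₖ ρ.transpose) ⊗ₖ
      (1 : Matrix (∀ i, A' i) (∀ i, A' i) ℂ)) * P))).PosSemidef
  ppt : ∀ S : Finset ι, (transposeAll S P).PosSemidef

/-- The objective values of the feasible points of the semidefinite program. -/
def sdpValues
    (N : Matrix (∀ i, A i) (∀ i, A i) ℂ →ₗ[ℂ] Matrix (∀ i, A' i) (∀ i, A' i) ℂ)
    (ρ : Matrix (∀ i, Ah i) (∀ i, Ah i) ℂ) : Set ℝ :=
  {l : ℝ | ∃ P Q, SDPFeasible N ρ l P Q}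

end Multipartite

end QSim

/-!
The root fidelity `‖√ω √τ‖₁` is the maximum of `Re tr X` over the blocks `X = √τ U √ω`, `‖U‖ ≤ 1`,
which are exactly those making `[ω, Xᴴ; X, τ]` positive semidefinite. A pure input state with
marginal `σ = Lᴴ L` is `(L ⊗ 1) Γ (L ⊗ 1)ᴴ`, so its two outputs are the Choi operators conjugated by
`L ⊗ 1`, and the admissible blocks for the outputs are the conjugates of the admissible blocks `Q`
for the Choi operators. The root channel fidelity is thus the minimum over states `σ` of the maximum
over `Q` of `Re tr (σ T)`, where `T` is the partial trace of `Q`. The minimax theorem exchanges the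
two, and `l ≤ Re tr (σ T)` for all states `σ` means `l • 1 ≤ Re T`. By Choi's theorem, and since
composing with partial transposes partially transposes the Choi operator, the remaining optimization
over completely PPT-preserving channels is the stated semidefinite program.
-/

namespace QSim

open scoped Matrix Matrix.Norms.L2Operator

section Contractions

variable {k m n p q : Type*}

theorem exists_isHermitian_generalizedInverse [Fintype n] {H : Matrix n n ℂ}
    (hH : H.IsHermitian) :
    ∃ G : Matrix n n ℂ, G.IsHermitian ∧ H * G * H = H ∧ G * H * G = G := by
  classical
  have hsa : IsSelfAdjoint H := hH
  have hcont : ∀ f : ℝ → ℝ, ContinuousOn f (spectrum ℝ H) := fun f =>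
    (Matrix.finite_real_spectrum (A := H)).continuousOn f
  have cfc_mul_mul (f g h : ℝ → ℝ) :
      cfc f H * cfc g H * cfc h H = cfc (fun x => f x * g x * h x) H := by
    rw [← cfc_mul f g H (hcont f) (hcont g), ← cfc_mul _ h H (hcont _) (hcont h)]
  have hHGH := cfc_mul_mul (fun x => x) (fun x => x⁻¹) (fun x => x)
  have hGHG := cfc_mul_mul (fun x => x⁻¹) (fun x => x) (fun x => x⁻¹)
  have inv_mul_mul_inv (x : ℝ) : x⁻¹ * x * x⁻¹ = x⁻¹ := by
    simpa only [inv_inv] using mul_inv_mul_cancel x⁻¹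
  simp only [mul_inv_mul_cancel, inv_mul_mul_inv, cfc_id' ℝ H] at hHGH hGHG
  exact ⟨cfc (fun x : ℝ => x⁻¹) H, cfc_predicate _ H, hHGH, hGHG⟩

theorem exists_contraction_of_gram_eq [Fintype m] [DecidableEq m] [Finite n] [Fintype p]
    {X : Matrix m n ℂ} {Y : Matrix p n ℂ} (h : Xᴴ * X = Yᴴ * Y) :
    ∃ V : Matrix p m ℂ, ‖V‖ ≤ 1 ∧ V * X = Y := by
  cases nonempty_fintype n
  obtain ⟨G, hG, hHGH, hGHG⟩ :=
    exists_isHermitian_generalizedInverse (Matrix.isHermitian_conjTranspose_mul_self X)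
  refine ⟨Y * G * Xᴴ, ?_, ?_⟩
  · have hVV : (Y * G * Xᴴ)ᴴ * (Y * G * Xᴴ) = X * G * Xᴴ := by
      calc (Y * G * Xᴴ)ᴴ * (Y * G * Xᴴ) = X * (G * (Yᴴ * Y) * G) * Xᴴ := by
            simp only [Matrix.conjTranspose_mul, Matrix.conjTranspose_conjTranspose, hG.eq,
              Matrix.mul_assoc]
        _ = X * G * Xᴴ := by rw [← h, hGHG]
    have hproj : IsStarProjection (X * G * Xᴴ) := by
      refine ⟨?_, Matrix.isHermitian_mul_mul_conjTranspose X hG⟩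
      calc X * G * Xᴴ * (X * G * Xᴴ) = X * (G * (Xᴴ * X) * G) * Xᴴ := by
            simp only [Matrix.mul_assoc]
        _ = X * G * Xᴴ := by rw [hGHG]
    have hnorm := hproj.norm_le
    rw [← hVV, Matrix.l2_opNorm_conjTranspose_mul_self] at hnorm
    exact abs_le_one_iff_mul_self_le_one.mpr hnorm |>.trans' (le_abs_self _)
  · classical
    have hzero : Yᴴ * Y * (G * (Yᴴ * Y) - 1) = 0 := by
      rw [← h, Matrix.mul_sub, ← Matrix.mul_assoc, hHGH, Matrix.mul_one, sub_self]
    rw [Matrix.conjTranspose_mul_self_mul_eq_zero, Matrix.mul_sub, Matrix.mul_one,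
      sub_eq_zero] at hzero
    rw [Matrix.mul_assoc, Matrix.mul_assoc, h, hzero]

variable [Fintype k] [DecidableEq k] [Fintype q]

theorem posSemidef_fromBlocks_one_one [DecidableEq q] {U : Matrix q k ℂ} (hU : ‖U‖ ≤ 1) :
    (Matrix.fromBlocks 1 Uᴴ U (1 : Matrix q q ℂ)).PosSemidef := by
  have hUU : U * Uᴴ ≤ 1 := by
    have h := CStarAlgebra.norm_le_one_iff_of_nonneg (U * Uᴴ)
      (Matrix.posSemidef_self_mul_conjTranspose U).nonneg
    rw [← h]
    refine (Matrix.l2_opNorm_mul _ _).trans (mul_le_one₀ hU (norm_nonneg _) ?_)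
    rwa [Matrix.l2_opNorm_conjTranspose]
  have := invertibleOne (α := Matrix k k ℂ)
  have hschur := Matrix.PosDef.fromBlocks₁₁ Uᴴ (1 : Matrix q q ℂ) (A := (1 : Matrix k k ℂ))
    Matrix.PosDef.one
  rw [Matrix.conjTranspose_conjTranspose] at hschur
  rw [hschur, inv_one, Matrix.mul_one, ← Matrix.le_iff]
  exact hUU

theorem posSemidef_fromBlocks_iff_exists_contraction [Finite n] [Finite p]
    (A : Matrix n k ℂ) (B : Matrix p q ℂ) (X : Matrix p n ℂ) :
    (Matrix.fromBlocks (A * Aᴴ) Xᴴ X (B * Bᴴ)).PosSemidef ↔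
      ∃ U : Matrix q k ℂ, ‖U‖ ≤ 1 ∧ X = B * U * Aᴴ := by
  classical
  cases nonempty_fintype n
  cases nonempty_fintype p
  constructor
  · intro h
    obtain ⟨G, hG⟩ := CStarAlgebra.nonneg_iff_eq_star_mul_self.mp h.nonneg
    rw [← Matrix.fromCols_toCols G, Matrix.star_eq_conjTranspose,
      Matrix.conjTranspose_fromCols_eq_fromRows_conjTranspose, Matrix.fromRows_mul_fromCols,
      Matrix.fromBlocks_inj] at hG
    obtain ⟨hA, -, hX, hB⟩ := hG
    obtain ⟨V, hV, hVA⟩ := exists_contraction_of_gram_eq (X := Aᴴ) (Y := G.toCols₁)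
      (by rw [Matrix.conjTranspose_conjTranspose, hA])
    obtain ⟨W, hW, hWB⟩ := exists_contraction_of_gram_eq (X := Bᴴ) (Y := G.toCols₂)
      (by rw [Matrix.conjTranspose_conjTranspose, hB])
    refine ⟨Wᴴ * V, ?_, ?_⟩
    · refine (Matrix.l2_opNorm_mul _ _).trans (mul_le_one₀ ?_ (norm_nonneg _) hV)
      rwa [Matrix.l2_opNorm_conjTranspose]
    · rw [hX, ← hVA, ← hWB]
      simp only [Matrix.conjTranspose_mul, Matrix.conjTranspose_conjTranspose, Matrix.mul_assoc]
  · rintro ⟨U, hU, rfl⟩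
    have h := (posSemidef_fromBlocks_one_one hU).mul_mul_conjTranspose_same
      (Matrix.fromBlocks A 0 0 B)
    simpa only [Matrix.fromBlocks_conjTranspose, Matrix.fromBlocks_multiply,
      Matrix.conjTranspose_zero, Matrix.mul_zero, Matrix.zero_mul, add_zero, zero_add,
      Matrix.mul_one, Matrix.conjTranspose_mul, Matrix.conjTranspose_conjTranspose,
      Matrix.mul_assoc] using h

end Contractions

section Completions

variable {m n p q : Type*}

/-- The off-diagonal blocks `Q` completing the diagonal blocks `w` and `t` to a positive
semidefinite matrix `[w, Qᴴ; Q, t]`. -/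
def psdCompletions (w : Matrix n n ℂ) (t : Matrix p p ℂ) : Set (Matrix p n ℂ) :=
  {Q | (Matrix.fromBlocks w Qᴴ Q t).PosSemidef}

theorem add_mem_psdCompletions {w₁ w₂ : Matrix n n ℂ} {t₁ t₂ : Matrix p p ℂ} {Q₁ Q₂ : Matrix p n ℂ}
    (h₁ : Q₁ ∈ psdCompletions w₁ t₁) (h₂ : Q₂ ∈ psdCompletions w₂ t₂) :
    Q₁ + Q₂ ∈ psdCompletions (w₁ + w₂) (t₁ + t₂) := by
  have h := Matrix.PosSemidef.add h₁ h₂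
  rwa [Matrix.fromBlocks_add, ← Matrix.conjTranspose_add] at h

theorem smul_mem_psdCompletions {w : Matrix n n ℂ} {t : Matrix p p ℂ} {Q : Matrix p n ℂ} {a : ℝ}
    (ha : 0 ≤ a) (hQ : Q ∈ psdCompletions w t) : a • Q ∈ psdCompletions (a • w) (a • t) := by
  have h := Matrix.PosSemidef.smul hQ ha
  have hstar : a • Qᴴ = (a • Q)ᴴ := by rw [Matrix.conjTranspose_smul, star_trivial]
  rwa [Matrix.fromBlocks_smul, hstar] at h

theorem sum_mem_psdCompletions {κ : Type*} {w : κ → Matrix n n ℂ} {t : κ → Matrix p p ℂ}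
    {Q : κ → Matrix p n ℂ} (s : Finset κ) (h : ∀ i ∈ s, Q i ∈ psdCompletions (w i) (t i)) :
    ∑ i ∈ s, Q i ∈ psdCompletions (∑ i ∈ s, w i) (∑ i ∈ s, t i) := by
  have hsum := Matrix.posSemidef_sum s h
  have hblocks : ∑ i ∈ s, Matrix.fromBlocks (w i) (Q i)ᴴ (Q i) (t i) =
      Matrix.fromBlocks (∑ i ∈ s, w i) (∑ i ∈ s, Q i)ᴴ (∑ i ∈ s, Q i) (∑ i ∈ s, t i) := by
    ext (x | x) (y | y) <;> simp [Matrix.sum_apply]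
  rwa [hblocks] at hsum

theorem convex_psdCompletions (w : Matrix n n ℂ) (t : Matrix p p ℂ) :
    Convex ℝ (psdCompletions w t) := by
  intro Q hQ Q' hQ' a b ha hb hab
  have h := add_mem_psdCompletions (smul_mem_psdCompletions ha hQ) (smul_mem_psdCompletions hb hQ')
  rwa [Convex.combo_self hab, Convex.combo_self hab] at h

theorem psdCompletions_mul_conjTranspose [Fintype m] [DecidableEq m] [Finite n] [Finite p]
    [Fintype q] (A : Matrix n m ℂ) (B : Matrix p q ℂ) :
    psdCompletions (A * Aᴴ) (B * Bᴴ) =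
      (fun U : Matrix q m ℂ => B * U * Aᴴ) '' Metric.closedBall 0 1 := by
  ext X
  simp only [psdCompletions, Set.mem_ofPred_eq, posSemidef_fromBlocks_iff_exists_contraction,
    Set.mem_image, mem_closedBall_zero_iff, eq_comm]

theorem conjTranspose_sqrt [Fintype n] [DecidableEq n] (X : Matrix n n ℂ) :
    (CFC.sqrt X)ᴴ = CFC.sqrt X :=
  (Matrix.nonneg_iff_posSemidef.mp (CFC.sqrt_nonneg X)).isHermitian

theorem psdCompletions_eq_image_closedBall [Fintype n] [DecidableEq n] [Fintype p] [DecidableEq p]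
    {w : Matrix n n ℂ} {t : Matrix p p ℂ} (hw : w.PosSemidef) (ht : t.PosSemidef) :
    psdCompletions w t =
      (fun U : Matrix p n ℂ => CFC.sqrt t * U * CFC.sqrt w) '' Metric.closedBall 0 1 := by
  have h := psdCompletions_mul_conjTranspose (CFC.sqrt w) (CFC.sqrt t)
  rwa [conjTranspose_sqrt, conjTranspose_sqrt, CFC.sqrt_mul_sqrt_self w hw.nonneg,
    CFC.sqrt_mul_sqrt_self t ht.nonneg] at h

theorem psdCompletions_conj [Finite m] [Fintype n] {w t : Matrix n n ℂ} (hw : w.PosSemidef)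
    (ht : t.PosSemidef) (L : Matrix m n ℂ) :
    psdCompletions (L * w * Lᴴ) (L * t * Lᴴ) = (fun Q => L * Q * Lᴴ) '' psdCompletions w t := by
  classical
  have factor {S : Matrix n n ℂ} (hS : S.PosSemidef) :
      L * S * Lᴴ = L * CFC.sqrt S * (L * CFC.sqrt S)ᴴ := by
    rw [Matrix.conjTranspose_mul, conjTranspose_sqrt, Matrix.mul_assoc L (CFC.sqrt S),
      ← Matrix.mul_assoc (CFC.sqrt S), CFC.sqrt_mul_sqrt_self S hS.nonneg, Matrix.mul_assoc]
  rw [factor hw, factor ht, psdCompletions_mul_conjTranspose,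
    psdCompletions_eq_image_closedBall hw ht, Set.image_image]
  simp only [Matrix.conjTranspose_mul, conjTranspose_sqrt, Matrix.mul_assoc]

theorem conj_mem_psdCompletions [Finite m] [Fintype n] {w t Q : Matrix n n ℂ}
    (hQ : Q ∈ psdCompletions w t) (L : Matrix m n ℂ) :
    L * Q * Lᴴ ∈ psdCompletions (L * w * Lᴴ) (L * t * Lᴴ) :=
  (psdCompletions_conj (hQ.submatrix Sum.inl) (hQ.submatrix Sum.inr) L).ge ⟨Q, hQ, rfl⟩

theorem isCompact_psdCompletions [Finite n] [Finite p] {w : Matrix n n ℂ} {t : Matrix p p ℂ}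
    (hw : w.PosSemidef) (ht : t.PosSemidef) : IsCompact (psdCompletions w t) := by
  classical
  cases nonempty_fintype n
  cases nonempty_fintype p
  rw [psdCompletions_eq_image_closedBall hw ht]
  exact (isCompact_closedBall 0 1).image (by fun_prop)

theorem re_trace_le_of_mem_psdCompletions [Fintype n] {w t Q : Matrix n n ℂ}
    (hQ : Q ∈ psdCompletions w t) : 2 * Q.trace.re ≤ w.trace.re + t.trace.re := by
  classical
  have h := (Matrix.PosSemidef.conjTranspose_mul_mul_same hQ
    (Matrix.fromRows (1 : Matrix n n ℂ) (-1))).trace_nonneg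
  rw [Matrix.conjTranspose_fromRows_eq_fromCols_conjTranspose, Matrix.fromCols_mul_fromBlocks,
    Matrix.fromCols_mul_fromRows] at h
  have hre := (Complex.le_def.mp h).1
  simp only [Complex.zero_re, Matrix.conjTranspose_one, Matrix.one_mul, Matrix.conjTranspose_neg,
    neg_mul, Matrix.mul_one, mul_neg, neg_add_rev, neg_neg, Matrix.trace_add, Matrix.trace_neg,
    Matrix.trace_conjTranspose, RCLike.star_def, Complex.add_re, Complex.neg_re,
    Complex.conj_re] at hre
  linarith

end Completions

theorem exists_conjTranspose_mul_self_eq {n : Type*} [Finite n] {σ : Matrix n n ℂ}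
    (hσ : σ.PosSemidef) : ∃ (m : ℕ) (L : Matrix (Fin m) n ℂ), Lᴴ * L = σ := by
  classical
  cases nonempty_fintype n
  obtain ⟨B, rfl⟩ := CStarAlgebra.nonneg_iff_eq_star_mul_self.mp hσ.nonneg
  refine ⟨_, B.submatrix (Fintype.equivFin n).symm id, ?_⟩
  rw [Matrix.conjTranspose_submatrix, Matrix.submatrix_mul_equiv, Matrix.submatrix_id_id]
  rfl

section TraceDuality

variable {n : Type*} [Fintype n]

theorem re_trace_mul_nonneg {σ A : Matrix n n ℂ} (hσ : σ.PosSemidef) (hA : A.PosSemidef) :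
    0 ≤ (σ * A).trace.re := by
  classical
  obtain ⟨B, rfl⟩ := CStarAlgebra.nonneg_iff_eq_star_mul_self.mp hσ.nonneg
  have h := (hA.mul_mul_conjTranspose_same B).trace_nonneg
  rw [Matrix.trace_mul_cycle] at h
  exact (Complex.le_def.mp h).1

theorem posSemidef_iff_forall_re_trace_mul_nonneg {A : Matrix n n ℂ} (hA : A.IsHermitian) :
    A.PosSemidef ↔ ∀ σ : Matrix n n ℂ, σ.PosSemidef → 0 ≤ (σ * A).trace.re := by
  refine ⟨fun h σ hσ => re_trace_mul_nonneg hσ h, fun h =>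
    .of_dotProduct_mulVec_nonneg hA fun x => ?_⟩
  have hx := h _ (Matrix.posSemidef_vecMulVec_self_star x)
  rw [Matrix.trace_mul_comm, Matrix.mul_vecMulVec, Matrix.trace_vecMulVec, dotProduct_comm] at hx
  exact Complex.le_def.mpr ⟨hx, (hA.im_star_dotProduct_mulVec_self x).symm⟩

theorem re_trace_mul_realPart {σ : Matrix n n ℂ} (hσ : σ.IsHermitian) (T : Matrix n n ℂ) :
    (σ * (realPart T : Matrix n n ℂ)).trace.re = (σ * T).trace.re := by
  have hstar : (σ * Tᴴ).trace = star (σ * T).trace := by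
    rw [← Matrix.trace_conjTranspose, Matrix.conjTranspose_mul, hσ.eq, Matrix.trace_mul_comm]
  rw [realPart_apply_coe, Matrix.star_eq_conjTranspose, Matrix.mul_smul, Matrix.mul_add,
    Matrix.trace_smul, Matrix.trace_add, hstar, Complex.smul_re, Complex.add_re, Complex.star_def,
    Complex.conj_re, smul_eq_mul]
  ring

variable [DecidableEq n]

theorem le_realPart_iff {l : ℝ} {T : Matrix n n ℂ} :
    (l : ℂ) • (1 : Matrix n n ℂ) ≤ (realPart T : Matrix n n ℂ) ↔
      ∀ σ : Matrix n n ℂ, σ.PosSemidef → l * σ.trace.re ≤ (σ * T).trace.re := by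
  have hH : ((realPart T : Matrix n n ℂ) - (l : ℂ) • 1).IsHermitian :=
    (realPart T).2.sub (IsSelfAdjoint.smul (Complex.conj_ofReal l) (.one _))
  rw [Matrix.le_iff, posSemidef_iff_forall_re_trace_mul_nonneg hH]
  refine forall₂_congr fun σ hσ => ?_
  rw [Matrix.mul_sub, Matrix.trace_sub, Complex.sub_re, re_trace_mul_realPart hσ.isHermitian,
    Matrix.mul_smul, Matrix.mul_one, Matrix.trace_smul, smul_eq_mul, Complex.re_ofReal_mul,
    sub_nonneg]

theorem le_realPart_iff_forall_isState {l : ℝ} {T : Matrix n n ℂ} :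
    (l : ℂ) • (1 : Matrix n n ℂ) ≤ (realPart T : Matrix n n ℂ) ↔
      ∀ σ : Matrix n n ℂ, IsState σ → l ≤ (σ * T).trace.re := by
  rw [le_realPart_iff]
  refine ⟨fun h σ hσ => by simpa only [hσ.2, Complex.one_re, mul_one] using h σ hσ.1,
    fun h σ hσ => ?_⟩
  obtain ⟨r, hr, htr : (r : ℂ) = σ.trace⟩ :=
    RCLike.nonneg_iff_exists_ofReal.mp hσ.trace_nonneg
  obtain rfl | hpos := hr.eq_or_lt
  · simp [hσ.trace_eq_zero_iff.mp htr.symm]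
  · have hstate : IsState (r⁻¹ • σ) := by
      refine ⟨hσ.smul (inv_nonneg.mpr hr), ?_⟩
      rw [Matrix.trace_smul, ← htr, Complex.real_smul, ← Complex.ofReal_mul,
        inv_mul_cancel₀ hpos.ne', Complex.ofReal_one]
    have hl := h _ hstate
    rwa [Matrix.smul_mul, Matrix.trace_smul, Complex.smul_re, smul_eq_mul, inv_mul_eq_div,
      le_div_iff₀ hpos, ← Complex.ofReal_re r, htr] at hl

theorem re_trace_mul_le_of_norm_le_one {S K : Matrix n n ℂ} (hS : S.PosSemidef) (hK : ‖K‖ ≤ 1) :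
    (S * K).trace.re ≤ S.trace.re := by
  have hle : (realPart K : Matrix n n ℂ) ≤ 1 := by
    refine (IsSelfAdjoint.le_algebraMap_norm_self (realPart K).2).trans ?_
    rw [← map_one (algebraMap ℝ (Matrix n n ℂ))]
    exact algebraMap_mono _ ((realPart.norm_le K).trans hK)
  have h := re_trace_mul_nonneg hS (Matrix.le_iff.mp hle)
  rw [Matrix.mul_sub, Matrix.mul_one, Matrix.trace_sub, Complex.sub_re,
    re_trace_mul_realPart hS.isHermitian] at h
  linarith

theorem norm_le_re_trace {X : Matrix n n ℂ} (hX : X.PosSemidef) : ‖X‖ ≤ X.trace.re := by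
  cases isEmpty_or_nonempty n
  · simp [Subsingleton.elim X 0]
  obtain ⟨i, hi⟩ : ‖X‖ ∈ Set.range hX.isHermitian.eigenvalues := by
    rw [← hX.isHermitian.spectrum_real_eq_range_eigenvalues]
    exact CStarAlgebra.norm_mem_spectrum_of_nonneg hX.nonneg
  rw [← hi, hX.isHermitian.trace_eq_sum_eigenvalues, Complex.re_sum]
  exact Finset.single_le_sum (f := hX.isHermitian.eigenvalues)
    (fun j _ => hX.eigenvalues_nonneg j) (Finset.mem_univ i)

end TraceDuality

section RootFidelity

variable {n : Type*} [Fintype n] [DecidableEq n]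

theorem isGreatest_traceNorm (Z : Matrix n n ℂ) :
    IsGreatest ((fun U : Matrix n n ℂ => (U * Z).trace.re) '' Metric.closedBall 0 1)
      (traceNorm Z) := by
  have hgram : (CFC.sqrt (Zᴴ * Z))ᴴ * CFC.sqrt (Zᴴ * Z) = Zᴴ * Z := by
    rw [conjTranspose_sqrt,
      CFC.sqrt_mul_sqrt_self _ (Matrix.posSemidef_conjTranspose_mul_self Z).nonneg]
  obtain ⟨V, hV, hVZ⟩ := exists_contraction_of_gram_eq hgram
  obtain ⟨W, hW, hWZ⟩ := exists_contraction_of_gram_eq hgram.symm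
  refine ⟨⟨W, mem_closedBall_zero_iff.mpr hW, by simp only [hWZ, traceNorm]⟩, ?_⟩
  rintro _ ⟨U, hU, rfl⟩
  have hUV : ‖U * V‖ ≤ 1 :=
    (norm_mul_le U V).trans (mul_le_one₀ (mem_closedBall_zero_iff.mp hU) (norm_nonneg V) hV)
  calc (U * Z).trace.re = (CFC.sqrt (Zᴴ * Z) * (U * V)).trace.re := by
        rw [Matrix.trace_mul_comm _ (U * V), Matrix.mul_assoc, hVZ]
    _ ≤ traceNorm Z := re_trace_mul_le_of_norm_le_one
        (Matrix.nonneg_iff_posSemidef.mp (CFC.sqrt_nonneg _)) hUV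

/-- The square root `‖√ω √τ‖₁` of the Uhlmann fidelity. -/
noncomputable def rootFidelity (ω τ : Matrix n n ℂ) : ℝ :=
  traceNorm (CFC.sqrt ω * CFC.sqrt τ)

theorem isGreatest_rootFidelity {ω τ : Matrix n n ℂ} (hω : ω.PosSemidef) (hτ : τ.PosSemidef) :
    IsGreatest ((fun X : Matrix n n ℂ => X.trace.re) '' psdCompletions ω τ)
      (rootFidelity ω τ) := by
  rw [psdCompletions_eq_image_closedBall hω hτ, Set.image_image]
  have hcycle (U : Matrix n n ℂ) :
      (CFC.sqrt τ * U * CFC.sqrt ω).trace = (U * (CFC.sqrt ω * CFC.sqrt τ)).trace := by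
    rw [Matrix.mul_assoc, Matrix.trace_mul_comm, Matrix.mul_assoc]
  simp only [hcycle]
  exact isGreatest_traceNorm (CFC.sqrt ω * CFC.sqrt τ)

theorem rootFidelity_nonneg (ω τ : Matrix n n ℂ) : 0 ≤ rootFidelity ω τ :=
  (Complex.nonneg_iff.mp
    (Matrix.nonneg_iff_posSemidef.mp (CFC.sqrt_nonneg _)).trace_nonneg).1

end RootFidelity

section States

variable {n : Type*} [Fintype n]

theorem convex_setOf_isState : Convex ℝ {σ : Matrix n n ℂ | IsState σ} := by
  rintro X ⟨hX, hX'⟩ Y ⟨hY, hY'⟩ a b ha hb hab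
  refine ⟨(hX.smul ha).add (hY.smul hb), ?_⟩
  rw [Matrix.trace_add, Matrix.trace_smul, Matrix.trace_smul, hX', hY', ← add_smul, hab, one_smul]

theorem isCompact_setOf_isState : IsCompact {σ : Matrix n n ℂ | IsState σ} := by
  classical
  refine Metric.isCompact_of_isClosed_isBounded ?_ ?_
  · have hclosed : IsClosed {σ : Matrix n n ℂ | 0 ≤ σ} := CStarAlgebra.isClosed_nonneg
    simp only [Matrix.nonneg_iff_posSemidef] at hclosed
    exact hclosed.inter (isClosed_eq (by fun_prop) continuous_const)
  · refine (Metric.isBounded_closedBall (x := (0 : Matrix n n ℂ)) (r := 1)).subset fun σ hσ => ?_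
    rw [mem_closedBall_zero_iff]
    simpa only [hσ.2, Complex.one_re] using norm_le_re_trace hσ.1

theorem exists_isState (n : Type*) [Fintype n] [Nonempty n] :
    ∃ σ : Matrix n n ℂ, IsState σ := by
  classical
  refine ⟨Matrix.vecMulVec (Pi.single (Classical.arbitrary n) 1)
    (star (Pi.single (Classical.arbitrary n) 1)), Matrix.posSemidef_vecMulVec_self_star _, ?_⟩
  simp

end States

section Minimax

variable {E F : Type*} [AddCommGroup E] [Module ℝ E] [TopologicalSpace E] [IsTopologicalAddGroup E]
  [ContinuousSMul ℝ E] [AddCommGroup F] [Module ℝ F] [TopologicalSpace F] [IsTopologicalAddGroup F]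
  [ContinuousSMul ℝ F]

theorem exists_forall_le_of_forall_exists_le (B : E →ₗ[ℝ] F →ₗ[ℝ] ℝ)
    (hleft : ∀ y, Continuous fun x => B x y) (hright : ∀ x, Continuous (B x))
    {X : Set E} (hXne : X.Nonempty) (hXconv : Convex ℝ X) (hXcomp : IsCompact X)
    {Y : Set F} (hYconv : Convex ℝ Y) (hYcomp : IsCompact Y) {r : ℝ}
    (h : ∀ x ∈ X, ∃ y ∈ Y, r ≤ B x y) : ∃ y ∈ Y, ∀ x ∈ X, r ≤ B x y := by
  have hYne : Y.Nonempty := (h _ hXne.some_mem).imp fun _ hy => hy.1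
  obtain ⟨x₀, hx₀, y₀, hy₀, hsaddle⟩ := Sion.exists_isSaddlePointOn (f := fun x y => B x y)
    hXne hXconv hXcomp
    (fun y _ => (hleft y).lowerSemicontinuous.lowerSemicontinuousOn _)
    (fun y _ => ((B.flip y).convexOn hXconv).quasiconvexOn)
    hYconv hYne hYcomp
    (fun x _ => (hright x).upperSemicontinuous.upperSemicontinuousOn _)
    (fun x _ => ((B x).concaveOn hYconv).quasiconcaveOn)
  obtain ⟨y, hy, hry⟩ := h x₀ hx₀
  exact ⟨y₀, hy₀, fun x hx => hry.trans (hsaddle x hx y hy)⟩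

end Minimax

section Blocks

variable {R C D : Type*}

theorem traceSnd_apply [Fintype D] (X : Matrix (C × D) (C × D) ℂ) (c c' : C) :
    traceSnd X c c' = (X.submatrix (Prod.mk c) (Prod.mk c')).trace :=
  rfl

theorem trace_traceSnd [Fintype C] [Fintype D] (X : Matrix (C × D) (C × D) ℂ) :
    (traceSnd X).trace = X.trace := by
  simp only [Matrix.trace, Matrix.diag_apply, traceSnd, Matrix.of_apply, Fintype.sum_prod_type]

theorem traceSnd_inv_card_smul_one [DecidableEq C] [Fintype D] [DecidableEq D] [Nonempty D] :
    traceSnd ((Fintype.card D : ℝ)⁻¹ • (1 : Matrix (C × D) (C × D) ℂ)) = 1 := by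
  ext c c'
  simp [traceSnd, Matrix.one_apply]

theorem idTensor_sum {κ : Type*} (s : Finset κ) (N : Matrix C C ℂ →ₗ[ℂ] Matrix D D ℂ)
    (X : κ → Matrix (R × C) (R × C) ℂ) :
    idTensor R N (∑ k ∈ s, X k) = ∑ k ∈ s, idTensor R N (X k) := by
  have hblock (r r' : R) : (∑ k ∈ s, X k).submatrix (Prod.mk r) (Prod.mk r') =
      ∑ k ∈ s, (X k).submatrix (Prod.mk r) (Prod.mk r') := by
    ext; simp [Matrix.sum_apply]
  ext x y
  change N ((∑ k ∈ s, X k).submatrix (Prod.mk x.1) (Prod.mk y.1)) x.2 y.2 = _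
  rw [hblock, map_sum, Matrix.sum_apply, Matrix.sum_apply]
  rfl

end Blocks

section ConjFst

variable {R C D : Type*} [Fintype C] [Fintype D] [DecidableEq D]

/-- The map `X ↦ (L ⊗ 1) X (L ⊗ 1)ᴴ`, conjugating the first tensor factor by `L`. -/
def conjFst (L : Matrix R C ℂ) (X : Matrix (C × D) (C × D) ℂ) : Matrix (R × D) (R × D) ℂ :=
  (L ⊗ₖ (1 : Matrix D D ℂ)) * X * (L ⊗ₖ (1 : Matrix D D ℂ))ᴴ

theorem conjFst_apply (L : Matrix R C ℂ) (X : Matrix (C × D) (C × D) ℂ) (x y : R × D) :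
    conjFst L X x y = ∑ c, ∑ c', L x.1 c * star (L y.1 c') * X (c, x.2) (c', y.2) := by
  have hleft (z : C × D) :
      ((L ⊗ₖ (1 : Matrix D D ℂ)) * X) x z = ∑ c, L x.1 c * X (c, x.2) z := by
    simp [Matrix.mul_apply, Fintype.sum_prod_type, Matrix.one_apply]
  rw [conjFst, Matrix.mul_apply, Fintype.sum_prod_type, Finset.sum_comm]
  simp only [hleft, Matrix.conjTranspose_apply, Matrix.kroneckerMap_apply, Matrix.one_apply,
    mul_ite, mul_one, mul_zero, apply_ite star, star_zero, Finset.sum_ite_irrel,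
    Finset.sum_const_zero, Finset.sum_ite_eq, Finset.mem_univ, if_true, Finset.sum_mul]
  rw [Finset.sum_comm]
  exact Finset.sum_congr rfl fun c _ => Finset.sum_congr rfl fun c' _ => mul_right_comm _ _ _

theorem conjFst_submatrix_mk (L : Matrix R C ℂ) (X : Matrix (C × D) (C × D) ℂ) (r r' : R) :
    (conjFst L X).submatrix (Prod.mk r) (Prod.mk r') =
      ∑ c, ∑ c', (L r c * star (L r' c')) • X.submatrix (Prod.mk c) (Prod.mk c') := by
  ext d d'
  simp only [Matrix.submatrix_apply, conjFst_apply, Matrix.sum_apply, Matrix.smul_apply,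
    smul_eq_mul]

theorem traceSnd_conjFst (L : Matrix R C ℂ) (X : Matrix (C × D) (C × D) ℂ) :
    traceSnd (conjFst L X) = L * traceSnd X * Lᴴ := by
  ext r r'
  simp only [traceSnd_apply, conjFst_submatrix_mk, Matrix.trace_sum, Matrix.trace_smul,
    smul_eq_mul, Matrix.mul_apply, Matrix.conjTranspose_apply, Finset.sum_mul]
  rw [Finset.sum_comm]
  exact Finset.sum_congr rfl fun c _ => Finset.sum_congr rfl fun c' _ => mul_right_comm _ _ _

theorem trace_conjFst [Fintype R] (L : Matrix R C ℂ) (X : Matrix (C × D) (C × D) ℂ) :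
    (conjFst L X).trace = (Lᴴ * L * traceSnd X).trace := by
  rw [← trace_traceSnd, traceSnd_conjFst, Matrix.trace_mul_cycle]

end ConjFst

section Choi

variable {R C D : Type*} [DecidableEq C]

theorem idTensor_conjFst [Fintype C] [Fintype D] [DecidableEq D] {K : Type*} [Fintype K]
    (N : Matrix C C ℂ →ₗ[ℂ] Matrix D D ℂ) (L : Matrix R K ℂ) (X : Matrix (K × C) (K × C) ℂ) :
    idTensor R N (conjFst L X) = conjFst L (idTensor K N X) := by
  have hblock (r r' : R) :
      N ((conjFst L X).submatrix (Prod.mk r) (Prod.mk r')) =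
        (conjFst L (idTensor K N X)).submatrix (Prod.mk r) (Prod.mk r') := by
    simp only [conjFst_submatrix_mk, map_sum, map_smul]
    rfl
  ext x y
  exact congr_fun₂ (hblock x.1 y.1) x.2 y.2

theorem posSemidef_gammaOp [Finite C] : (gammaOp C).PosSemidef :=
  Matrix.posSemidef_vecMulVec_self_star _

theorem choi_apply (N : Matrix C C ℂ →ₗ[ℂ] Matrix D D ℂ) (x y : C × D) :
    choi N x y = N (Matrix.single x.1 y.1 1) x.2 y.2 := by
  have hblock : (gammaOp C).submatrix (Prod.mk x.1) (Prod.mk y.1) = Matrix.single x.1 y.1 1 := by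
    ext c c'
    by_cases h : x.1 = c <;> by_cases h' : y.1 = c' <;>
      simp [gammaOp, gammaVec, Matrix.vecMulVec_apply, h, h']
  rw [← hblock]
  rfl

theorem traceSnd_choi_apply [Fintype D] (N : Matrix C C ℂ →ₗ[ℂ] Matrix D D ℂ) (c c' : C) :
    traceSnd (choi N) c c' = (N (Matrix.single c c' 1)).trace := by
  simp only [traceSnd, Matrix.of_apply, choi_apply, Matrix.trace, Matrix.diag_apply]

variable [Fintype C]

theorem traceSnd_gammaOp : traceSnd (gammaOp C) = 1 := by
  ext c c'
  simp [traceSnd, gammaOp, gammaVec, Matrix.vecMulVec_apply, Matrix.one_apply]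

theorem exists_eq_sum_conjFst_gammaOp [Finite R] {X : Matrix (R × C) (R × C) ℂ}
    (hX : X.PosSemidef) :
    ∃ (m : ℕ) (L : Fin m → Matrix R C ℂ), X = ∑ k, conjFst (L k) (gammaOp C) := by
  cases nonempty_fintype R
  obtain ⟨m, v, rfl⟩ := Matrix.posSemidef_iff_eq_sum_vecMulVec.mp hX
  refine ⟨m, fun k => .of (Function.curry (v k)), Finset.sum_congr rfl fun k _ => ?_⟩
  have hvec : (Matrix.of (Function.curry (v k)) ⊗ₖ (1 : Matrix C C ℂ)) *ᵥ gammaVec C = v k := by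
    ext ⟨r, c⟩
    simp [Matrix.mulVec, dotProduct, Fintype.sum_prod_type, gammaVec, Matrix.one_apply]
  rw [conjFst, gammaOp, Matrix.mul_vecMulVec, Matrix.vecMulVec_mul, hvec, ← Matrix.star_mulVec,
    hvec]

/-- The linear map with a given Choi operator. -/
noncomputable def ofChoi (J : Matrix (C × D) (C × D) ℂ) : Matrix C C ℂ →ₗ[ℂ] Matrix D D ℂ :=
  (Matrix.stdBasis ℂ C C).constr ℂ fun c => J.submatrix (Prod.mk c.1) (Prod.mk c.2)

theorem choi_ofChoi (J : Matrix (C × D) (C × D) ℂ) : choi (ofChoi J) = J := by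
  ext x y
  rw [choi_apply, ofChoi, ← Matrix.stdBasis_eq_single, Module.Basis.constr_basis]
  rfl

theorem traceSnd_choi_eq_one_iff [Fintype D] (N : Matrix C C ℂ →ₗ[ℂ] Matrix D D ℂ) :
    traceSnd (choi N) = 1 ↔ ∀ X, (N X).trace = X.trace := by
  have hsingle (c c' : C) : (Matrix.single c c' (1 : ℂ)).trace = (1 : Matrix C C ℂ) c c' := by
    rcases eq_or_ne c c' with rfl | hne
    · simp
    · rw [Matrix.trace_single_eq_of_ne _ _ _ hne, Matrix.one_apply_ne hne]
  constructor
  · intro h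
    suffices Matrix.traceLinearMap D ℂ ℂ ∘ₗ N = Matrix.traceLinearMap C ℂ ℂ from
      LinearMap.congr_fun this
    refine (Matrix.stdBasis ℂ C C).ext fun ⟨c, c'⟩ => ?_
    rw [Matrix.stdBasis_eq_single, LinearMap.comp_apply, Matrix.traceLinearMap_apply,
      Matrix.traceLinearMap_apply, ← traceSnd_choi_apply, h, hsingle]
  · intro h
    ext c c'
    rw [traceSnd_choi_apply, h, hsingle]

end Choi

section ChoiTheorem

variable {R C D : Type*} [Finite C] [DecidableEq C] [Finite D]

theorem posSemidef_idTensor [Finite R] {N : Matrix C C ℂ →ₗ[ℂ] Matrix D D ℂ}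
    (hN : (choi N).PosSemidef) {X : Matrix (R × C) (R × C) ℂ} (hX : X.PosSemidef) :
    (idTensor R N X).PosSemidef := by
  classical
  cases nonempty_fintype C
  cases nonempty_fintype D
  obtain ⟨m, L, rfl⟩ := exists_eq_sum_conjFst_gammaOp hX
  simp only [idTensor_sum, idTensor_conjFst]
  exact Matrix.posSemidef_sum _ fun k _ => Matrix.PosSemidef.mul_mul_conjTranspose_same hN _

theorem isCP_iff_posSemidef_choi (N : Matrix C C ℂ →ₗ[ℂ] Matrix D D ℂ) :
    IsCP N ↔ (choi N).PosSemidef := by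
  refine ⟨fun h => ?_, fun h _ _ => posSemidef_idTensor h⟩
  obtain ⟨n, ⟨e⟩⟩ := Finite.exists_equiv_fin C
  have hΓ := h _ _ (posSemidef_gammaOp.submatrix (Prod.map e.symm id))
  convert hΓ.submatrix (Prod.map e id) using 1
  ext x y
  simp [choi, idTensor]

end ChoiTheorem

section ChannelFidelity

variable {R C D : Type*} [Fintype C] [Fintype D]

section Fidelities

variable [DecidableEq D]

theorem bddBelow_fidelities (N N' : Matrix C C ℂ →ₗ[ℂ] Matrix D D ℂ) :
    BddBelow {f : ℝ | ∃ (n : ℕ) (ρ : Matrix (Fin n × C) (Fin n × C) ℂ), IsState ρ ∧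
      f = fidelity (idTensor (Fin n) N ρ) (idTensor (Fin n) N' ρ)} := by
  refine ⟨0, ?_⟩
  rintro _ ⟨n, ρ, -, rfl⟩
  exact sq_nonneg _

theorem channelFidelity_nonneg (N N' : Matrix C C ℂ →ₗ[ℂ] Matrix D D ℂ) :
    0 ≤ channelFidelity N N' := by
  refine Real.sInf_nonneg ?_
  rintro _ ⟨n, ρ, -, rfl⟩
  exact sq_nonneg _

theorem sqrt_channelFidelity_le (N N' : Matrix C C ℂ →ₗ[ℂ] Matrix D D ℂ) {n : ℕ}
    {ρ : Matrix (Fin n × C) (Fin n × C) ℂ} (hρ : IsState ρ) :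
    √(channelFidelity N N') ≤ rootFidelity (idTensor (Fin n) N ρ) (idTensor (Fin n) N' ρ) :=
  Real.sqrt_le_iff.mpr ⟨rootFidelity_nonneg _ _,
    csInf_le (bddBelow_fidelities N N') ⟨n, ρ, hρ, rfl⟩⟩

theorem le_sqrt_channelFidelity [Nonempty C] {N N' : Matrix C C ℂ →ₗ[ℂ] Matrix D D ℂ} {l : ℝ}
    (h : ∀ (n : ℕ) (ρ : Matrix (Fin n × C) (Fin n × C) ℂ), IsState ρ →
      l ≤ rootFidelity (idTensor (Fin n) N ρ) (idTensor (Fin n) N' ρ)) :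
    l ≤ √(channelFidelity N N') := by
  obtain hl | hl := le_total l 0
  · exact hl.trans (Real.sqrt_nonneg _)
  refine Real.le_sqrt_of_sq_le (le_csInf ?_ ?_)
  · obtain ⟨ρ, hρ⟩ := exists_isState (Fin 1 × C)
    exact ⟨_, 1, ρ, hρ, rfl⟩
  · rintro _ ⟨n, ρ, hρ, rfl⟩
    exact pow_le_pow_left₀ hl (h n ρ hρ) 2

end Fidelities

variable [DecidableEq C] {N N' : Matrix C C ℂ →ₗ[ℂ] Matrix D D ℂ}

/-- The values of `l` feasible for the semidefinite program whose optimum is the root channel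
fidelity of `N` and `N'`. -/
def rootFidelityValues (N N' : Matrix C C ℂ →ₗ[ℂ] Matrix D D ℂ) : Set ℝ :=
  {l | ∃ Q ∈ psdCompletions (choi N) (choi N'),
    (l : ℂ) • (1 : Matrix C C ℂ) ≤ (realPart (traceSnd Q) : Matrix C C ℂ)}

theorem exists_mem_psdCompletions_idTensor [Fintype R] {Q : Matrix (C × D) (C × D) ℂ}
    (hQ : Q ∈ psdCompletions (choi N) (choi N')) {X : Matrix (R × C) (R × C) ℂ}
    (hX : X.PosSemidef) :
    ∃ Y ∈ psdCompletions (idTensor R N X) (idTensor R N' X), ∃ σ : Matrix C C ℂ,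
      σ.PosSemidef ∧ σ.trace = X.trace ∧ Y.trace = (σ * traceSnd Q).trace := by
  classical
  obtain ⟨m, L, rfl⟩ := exists_eq_sum_conjFst_gammaOp hX
  refine ⟨∑ k, conjFst (L k) Q, ?_, ∑ k, (L k)ᴴ * L k,
    Matrix.posSemidef_sum _ fun k _ => Matrix.posSemidef_conjTranspose_mul_self _, ?_, ?_⟩
  · simp only [idTensor_sum, idTensor_conjFst]
    exact sum_mem_psdCompletions _ fun k _ => conj_mem_psdCompletions hQ _
  · simp only [Matrix.trace_sum, trace_conjFst, traceSnd_gammaOp, Matrix.mul_one]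
  · simp only [Matrix.trace_sum, trace_conjFst, Finset.sum_mul]

theorem two_mul_card_mul_le_of_mem_rootFidelityValues {l : ℝ} (hl : l ∈ rootFidelityValues N N') :
    2 * (Fintype.card C * l) ≤ (choi N).trace.re + (choi N').trace.re := by
  obtain ⟨Q, hQ, hle⟩ := hl
  have h := le_realPart_iff.mp hle 1 .one
  rw [Matrix.one_mul, trace_traceSnd, Matrix.trace_one, Complex.natCast_re] at h
  linarith [re_trace_le_of_mem_psdCompletions hQ]

variable [DecidableEq D]

theorem le_rootFidelity_of_mem_rootFidelityValues [Fintype R] [DecidableEq R] {l : ℝ}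
    (hl : l ∈ rootFidelityValues N N') {X : Matrix (R × C) (R × C) ℂ} (hX : IsState X) :
    l ≤ rootFidelity (idTensor R N X) (idTensor R N' X) := by
  obtain ⟨Q, hQ, hle⟩ := hl
  obtain ⟨Y, hY, σ, hσ, htr, hYσ⟩ := exists_mem_psdCompletions_idTensor hQ hX.1
  calc l ≤ (σ * traceSnd Q).trace.re :=
        le_realPart_iff_forall_isState.mp hle σ ⟨hσ, htr.trans hX.2⟩
    _ = Y.trace.re := by rw [hYσ]
    _ ≤ rootFidelity (idTensor R N X) (idTensor R N' X) :=
        (isGreatest_rootFidelity (hY.submatrix Sum.inl) (hY.submatrix Sum.inr)).2 ⟨Y, hY, rfl⟩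

theorem exists_sqrt_channelFidelity_le (hN : (choi N).PosSemidef) (hN' : (choi N').PosSemidef)
    {σ : Matrix C C ℂ} (hσ : IsState σ) :
    ∃ Q ∈ psdCompletions (choi N) (choi N'),
      √(channelFidelity N N') ≤ (σ * traceSnd Q).trace.re := by
  obtain ⟨n, L, hL⟩ := exists_conjTranspose_mul_self_eq hσ.1
  have hstate : IsState (conjFst L (gammaOp C)) := by
    refine ⟨posSemidef_gammaOp.mul_mul_conjTranspose_same _, ?_⟩
    rw [trace_conjFst, traceSnd_gammaOp, Matrix.mul_one, hL, hσ.2]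
  obtain ⟨Y, hY, htr⟩ := (isGreatest_rootFidelity (posSemidef_idTensor hN hstate.1)
    (posSemidef_idTensor hN' hstate.1)).1
  have hoptimal := (sqrt_channelFidelity_le N N' hstate).trans_eq htr.symm
  rw [idTensor_conjFst, idTensor_conjFst] at hY
  obtain ⟨Q, hQ, rfl⟩ := (psdCompletions_conj hN hN' _).le hY
  refine ⟨Q, hQ, ?_⟩
  rwa [← hL, ← trace_conjFst]

theorem isGreatest_sqrt_channelFidelity [Nonempty C] (hN : (choi N).PosSemidef)
    (hN' : (choi N').PosSemidef) :
    IsGreatest (rootFidelityValues N N') √(channelFidelity N N') := by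
  refine ⟨?_, fun l hl => le_sqrt_channelFidelity fun n ρ hρ =>
    le_rootFidelity_of_mem_rootFidelityValues hl hρ⟩
  let traceSndₗ : Matrix (C × D) (C × D) ℂ →ₗ[ℝ] Matrix C C ℂ :=
    { toFun := traceSnd
      map_add' := fun X Y => by ext; simp [traceSnd, Finset.sum_add_distrib]
      map_smul' := fun a X => by ext; simp [traceSnd, Finset.mul_sum] }
  -- The pairing `(σ, Q) ↦ Re tr (σ * traceSnd Q)`.
  let B : Matrix C C ℂ →ₗ[ℝ] Matrix (C × D) (C × D) ℂ →ₗ[ℝ] ℝ :=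
    ((LinearMap.mul ℝ (Matrix C C ℂ)).compr₂
      (Complex.reLm ∘ₗ Matrix.traceLinearMap C ℝ ℂ)).compl₂ traceSndₗ
  obtain ⟨Q, hQ, hle⟩ := exists_forall_le_of_forall_exists_le B
    (fun Q => (B.flip Q).continuous_of_finiteDimensional)
    (fun σ => (B σ).continuous_of_finiteDimensional)
    (exists_isState C) convex_setOf_isState isCompact_setOf_isState
    (convex_psdCompletions _ _) (isCompact_psdCompletions hN hN')
    fun σ hσ => exists_sqrt_channelFidelity_le hN hN' hσ
  exact ⟨Q, hQ, le_realPart_iff_forall_isState.mpr hle⟩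

end ChannelFidelity

section Simulation

variable {C R D : Type*}

theorem isCP_simulate [Finite C] [Finite R] {P : Matrix (C × R) (C × R) ℂ →ₗ[ℂ] Matrix D D ℂ}
    {ρ : Matrix R R ℂ} (hP : IsCP P) (hρ : ρ.PosSemidef) : IsCP (simulate P ρ) := fun n _ hX =>
  hP n _ ((hX.kronecker hρ).submatrix (Equiv.prodAssoc (Fin n) C R).symm)

variable [Fintype C] [DecidableEq C] [Fintype D]

theorem trace_choi_simulate [Fintype R] {P : Matrix (C × R) (C × R) ℂ →ₗ[ℂ] Matrix D D ℂ}
    (hP : ∀ X, (P X).trace = X.trace) (ρ : Matrix R R ℂ) :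
    (choi (simulate P ρ)).trace = Fintype.card C * ρ.trace := by
  have hsingle (c : C) : (simulate P ρ (Matrix.single c c 1)).trace = ρ.trace := by
    change (P (Matrix.single c c 1 ⊗ₖ ρ)).trace = _
    rw [hP, Matrix.trace_kronecker, Matrix.trace_single_eq_same, one_mul]
  rw [← trace_traceSnd]
  simp only [Matrix.trace, Matrix.diag_apply, traceSnd_choi_apply] at hsingle ⊢
  simp only [hsingle, Finset.sum_const, Finset.card_univ, nsmul_eq_mul]

variable [DecidableEq D]

theorem isGreatest_sqrt_channelFidelity_simulate [Nonempty C] [Finite R]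
    {N : Matrix C C ℂ →ₗ[ℂ] Matrix D D ℂ} {P : Matrix (C × R) (C × R) ℂ →ₗ[ℂ] Matrix D D ℂ}
    {ρ : Matrix R R ℂ} (hN : IsCP N) (hP : IsCP P) (hρ : ρ.PosSemidef) :
    IsGreatest (rootFidelityValues N (simulate P ρ)) √(channelFidelity N (simulate P ρ)) :=
  isGreatest_sqrt_channelFidelity ((isCP_iff_posSemidef_choi N).mp hN)
    ((isCP_iff_posSemidef_choi _).mp (isCP_simulate hP hρ))

variable [Fintype R] [DecidableEq R]

theorem choi_simulate (P : Matrix (C × R) (C × R) ℂ →ₗ[ℂ] Matrix D D ℂ) (ρ : Matrix R R ℂ) :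
    choi (simulate P ρ) =
      traceMid ((((1 : Matrix C C ℂ) ⊗ₖ ρᵀ) ⊗ₖ (1 : Matrix D D ℂ)) * choi P) := by
  ext ⟨c, d⟩ ⟨c', d'⟩
  have hinput : Matrix.single c c' 1 ⊗ₖ ρ =
      ∑ r, ∑ r', ρ r' r • Matrix.single (c, r') (c', r) (1 : ℂ) := by
    ext x y
    simp [Matrix.single_apply, Matrix.sum_apply, Prod.ext_iff, ite_and]
  have hprod (r : R) :
      ((((1 : Matrix C C ℂ) ⊗ₖ ρᵀ) ⊗ₖ (1 : Matrix D D ℂ)) * choi P) ((c, r), d) ((c', r), d') =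
        ∑ r', ρ r' r * choi P ((c, r'), d) ((c', r), d') := by
    simp [Matrix.mul_apply, Fintype.sum_prod_type, Matrix.one_apply]
  rw [choi_apply]
  change P (Matrix.single c c' 1 ⊗ₖ ρ) d d' = ∑ r, _
  simp only [hprod, hinput, map_sum, map_smul, Matrix.sum_apply, Matrix.smul_apply, smul_eq_mul,
    choi_apply]

end Simulation

section PPTChannels

variable {ι : Type*} [DecidableEq ι]

theorem piecewise_piecewise_swap {B : ι → Type*} (S : Finset ι) (x y : ∀ i, B i) :
    S.piecewise (S.piecewise x y) (S.piecewise y x) = x := by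
  funext i
  by_cases hi : i ∈ S <;> simp [hi]

theorem piecewise_eq_and_piecewise_eq_iff {B : ι → Type*} {S : Finset ι} {a b x y : ∀ i, B i} :
    S.piecewise b a = x ∧ S.piecewise a b = y ↔ a = S.piecewise y x ∧ b = S.piecewise x y := by
  constructor
  · rintro ⟨rfl, rfl⟩
    exact ⟨(piecewise_piecewise_swap S a b).symm, (piecewise_piecewise_swap S b a).symm⟩
  · rintro ⟨rfl, rfl⟩
    exact ⟨piecewise_piecewise_swap S x y, piecewise_piecewise_swap S y x⟩

theorem piecewise_swap_eq_iff {B : ι → Type*} {S : Finset ι} {x y : ∀ i, B i} :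
    S.piecewise y x = S.piecewise x y ↔ x = y := by
  refine ⟨fun h => ?_, by rintro rfl; rfl⟩
  obtain ⟨hx, hy⟩ := piecewise_eq_and_piecewise_eq_iff.mp ⟨h, rfl⟩
  exact hx.trans hy.symm

variable {A Ah A' : ι → Type*} [∀ i, DecidableEq (A i)] [∀ i, DecidableEq (Ah i)] [Fintype ι]

theorem transposeIn_single (S : Finset ι) (a b : (∀ i, A i) × (∀ i, Ah i)) :
    transposeIn S (Matrix.single a b (1 : ℂ)) =
      Matrix.single (S.piecewise b.1 a.1, S.piecewise b.2 a.2)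
        (S.piecewise a.1 b.1, S.piecewise a.2 b.2) 1 := by
  ext x y
  change Matrix.single a b (1 : ℂ) (S.piecewise y.1 x.1, S.piecewise y.2 x.2)
    (S.piecewise x.1 y.1, S.piecewise x.2 y.2) = _
  rw [Matrix.single_apply, Matrix.single_apply]
  congr 1
  simp only [Prod.ext_iff, and_and_and_comm, piecewise_eq_and_piecewise_eq_iff]

theorem choi_transposeOut_comp_transposeIn (S : Finset ι)
    (P : Matrix ((∀ i, A i) × (∀ i, Ah i)) ((∀ i, A i) × (∀ i, Ah i)) ℂ →ₗ[ℂ]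
      Matrix (∀ i, A' i) (∀ i, A' i) ℂ) :
    choi (transposeOut S ∘ₗ P ∘ₗ transposeIn S) = transposeAll S (choi P) := by
  ext x y
  rw [choi_apply, LinearMap.comp_apply, LinearMap.comp_apply, transposeIn_single]
  change P _ (S.piecewise y.2 x.2) (S.piecewise x.2 y.2) = choi P _ _
  rw [choi_apply]

theorem transposeAll_smul_one [∀ i, DecidableEq (A' i)] (S : Finset ι) (c : ℝ) :
    transposeAll S (c • (1 : Matrix (((∀ i, A i) × (∀ i, Ah i)) × (∀ i, A' i)) _ ℂ)) = c • 1 := by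
  ext x y
  simp only [transposeAll, Matrix.of_apply, Matrix.smul_apply, Matrix.one_apply, Prod.ext_iff,
    piecewise_swap_eq_iff]

variable [∀ i, Fintype (A i)] [∀ i, Fintype (Ah i)] [∀ i, Fintype (A' i)]

theorem isCPPTP_iff {P : Matrix ((∀ i, A i) × (∀ i, Ah i)) ((∀ i, A i) × (∀ i, Ah i)) ℂ →ₗ[ℂ]
      Matrix (∀ i, A' i) (∀ i, A' i) ℂ} :
    IsCPPTP P ↔ (choi P).PosSemidef ∧ traceSnd (choi P) = 1 ∧
      ∀ S : Finset ι, (transposeAll S (choi P)).PosSemidef := by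
  rw [IsCPPTP, IsChannel, isCP_iff_posSemidef_choi, traceSnd_choi_eq_one_iff, and_assoc]
  simp only [isCP_iff_posSemidef_choi, choi_transposeOut_comp_transposeIn]

theorem exists_isCPPTP (A Ah A' : ι → Type*) [∀ i, Fintype (A i)] [∀ i, Fintype (Ah i)]
    [∀ i, Fintype (A' i)] [Nonempty (∀ i, A' i)] :
    ∃ P : Matrix ((∀ i, A i) × (∀ i, Ah i)) ((∀ i, A i) × (∀ i, Ah i)) ℂ →ₗ[ℂ]
      Matrix (∀ i, A' i) (∀ i, A' i) ℂ, IsCPPTP P := by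
  classical
  -- The channel discarding its input and preparing the maximally mixed state.
  refine ⟨ofChoi ((Fintype.card (∀ i, A' i) : ℝ)⁻¹ • 1), ?_⟩
  have hpos : ((Fintype.card (∀ i, A' i) : ℝ)⁻¹ •
      (1 : Matrix (((∀ i, A i) × (∀ i, Ah i)) × (∀ i, A' i)) _ ℂ)).PosSemidef :=
    Matrix.PosSemidef.one.smul (by positivity)
  rw [isCPPTP_iff, choi_ofChoi]
  exact ⟨hpos, traceSnd_inv_card_smul_one, fun S => by rwa [transposeAll_smul_one]⟩

end PPTChannels

section SemidefiniteProgram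

variable {ι : Type*} [DecidableEq ι] [Fintype ι] {A Ah A' : ι → Type*}
  [∀ i, Fintype (A i)] [∀ i, Fintype (Ah i)] [∀ i, Fintype (A' i)] [∀ i, DecidableEq (A' i)]
  {N : Matrix (∀ i, A i) (∀ i, A i) ℂ →ₗ[ℂ] Matrix (∀ i, A' i) (∀ i, A' i) ℂ}
  {ρ : Matrix (∀ i, Ah i) (∀ i, Ah i) ℂ} {l : ℝ}

/-- The root channel fidelities `√F(N, Ñ)` achieved by the completely PPT-preserving channels. -/
def rootFidelities
    (N : Matrix (∀ i, A i) (∀ i, A i) ℂ →ₗ[ℂ] Matrix (∀ i, A' i) (∀ i, A' i) ℂ)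
    (ρ : Matrix (∀ i, Ah i) (∀ i, Ah i) ℂ) : Set ℝ :=
  (fun P => √(channelFidelity N (simulate P ρ))) '' {P | IsCPPTP P}

theorem nonneg_of_mem_rootFidelities (hl : l ∈ rootFidelities N ρ) : 0 ≤ l := by
  obtain ⟨P, -, rfl⟩ := hl
  exact Real.sqrt_nonneg _

theorem rootFidelities_nonempty [Nonempty (∀ i, A' i)] : (rootFidelities N ρ).Nonempty := by
  obtain ⟨P, hP⟩ := exists_isCPPTP A Ah A'
  exact ⟨_, P, hP, rfl⟩

theorem simErrors_eq_image_rootFidelities :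
    simErrors N ρ = (fun r => 1 - r ^ 2) '' rootFidelities N ρ := by
  ext e
  simp only [simErrors, rootFidelities, Set.mem_ofPred_eq, Set.image_image,
    Real.sq_sqrt (channelFidelity_nonneg _ _), Set.mem_image, eq_comm]

variable [∀ i, DecidableEq (A i)] [∀ i, DecidableEq (Ah i)]

theorem sdpFeasible_choi_iff
    {P : Matrix ((∀ i, A i) × (∀ i, Ah i)) ((∀ i, A i) × (∀ i, Ah i)) ℂ →ₗ[ℂ]
      Matrix (∀ i, A' i) (∀ i, A' i) ℂ}
    {Q : Matrix ((∀ i, A i) × (∀ i, A' i)) ((∀ i, A i) × (∀ i, A' i)) ℂ} :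
    SDPFeasible N ρ l (choi P) Q ↔ 0 ≤ l ∧ IsCPPTP P ∧
      Q ∈ psdCompletions (choi N) (choi (simulate P ρ)) ∧
      (l : ℂ) • (1 : Matrix (∀ i, A i) (∀ i, A i) ℂ) ≤
        (realPart (traceSnd Q) : Matrix (∀ i, A i) (∀ i, A i) ℂ) := by
  rw [isCPPTP_iff, choi_simulate]
  exact ⟨fun h => ⟨h.l_nonneg, ⟨h.P_nonneg, h.trace_P, h.ppt⟩, h.block_nonneg, h.le_realPart⟩,
    fun ⟨hl, ⟨hP, htr, hppt⟩, hblock, hle⟩ => ⟨hl, hP, hle, htr, hblock, hppt⟩⟩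

theorem mem_sdpValues_iff :
    l ∈ sdpValues N ρ ↔ 0 ≤ l ∧ ∃ P, IsCPPTP P ∧ l ∈ rootFidelityValues N (simulate P ρ) := by
  constructor
  · rintro ⟨J, Q, h⟩
    rw [← choi_ofChoi J, sdpFeasible_choi_iff] at h
    obtain ⟨hl, hP, hQ⟩ := h
    exact ⟨hl, _, hP, Q, hQ⟩
  · rintro ⟨hl, P, hP, Q, hQ⟩
    exact ⟨choi P, Q, sdpFeasible_choi_iff.mpr ⟨hl, hP, hQ⟩⟩

theorem rootFidelities_subset_sdpValues [Nonempty (∀ i, A i)] (hN : IsCP N) (hρ : ρ.PosSemidef) :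
    rootFidelities N ρ ⊆ sdpValues N ρ := by
  rintro _ ⟨P, hP, rfl⟩
  exact mem_sdpValues_iff.mpr ⟨Real.sqrt_nonneg _, P, hP,
    (isGreatest_sqrt_channelFidelity_simulate hN hP.1.1 hρ).1⟩

theorem exists_mem_rootFidelities_ge [Nonempty (∀ i, A i)] (hN : IsCP N) (hρ : ρ.PosSemidef)
    (hl : l ∈ sdpValues N ρ) : ∃ r ∈ rootFidelities N ρ, l ≤ r := by
  obtain ⟨-, P, hP, hl⟩ := mem_sdpValues_iff.mp hl
  exact ⟨_, ⟨P, hP, rfl⟩, (isGreatest_sqrt_channelFidelity_simulate hN hP.1.1 hρ).2 hl⟩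

theorem bddAbove_sdpValues [Nonempty (∀ i, A i)] : BddAbove (sdpValues N ρ) := by
  have hcard : (0 : ℝ) < 2 * Fintype.card (∀ i, A i) := by positivity
  refine ⟨((choi N).trace.re + Fintype.card (∀ i, A i) * ρ.trace.re) /
    (2 * Fintype.card (∀ i, A i)), fun l hl => ?_⟩
  obtain ⟨-, P, hP, hl⟩ := mem_sdpValues_iff.mp hl
  have h := two_mul_card_mul_le_of_mem_rootFidelityValues hl
  rw [trace_choi_simulate hP.1.2, ← Complex.ofReal_natCast, Complex.re_ofReal_mul] at h
  rw [le_div_iff₀ hcard]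
  linarith

end SemidefiniteProgram

section OneSubSq

theorem antitoneOn_one_sub_sq : AntitoneOn (fun r : ℝ => 1 - r ^ 2) (Set.Ici 0) :=
  fun _ ha _ _ hab => sub_le_sub_left (pow_le_pow_left₀ ha hab 2) 1

theorem bddBelow_image_one_sub_sq {s : Set ℝ} (hne : s.Nonempty) (hbdd : BddAbove s)
    (hnonneg : s ⊆ Set.Ici 0) : BddBelow ((fun r => 1 - r ^ 2) '' s) := by
  obtain ⟨r, hr⟩ := hne
  obtain ⟨b, hb⟩ := hbdd
  exact antitoneOn_one_sub_sq.map_bddAbove hnonneg ⟨b, hb, (hnonneg hr).trans (hb hr)⟩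

theorem sInf_image_one_sub_sq {s : Set ℝ} (hne : s.Nonempty) (hbdd : BddAbove s)
    (hnonneg : s ⊆ Set.Ici 0) : sInf ((fun r => 1 - r ^ 2) '' s) = 1 - sSup s ^ 2 :=
  ((antitoneOn_one_sub_sq.mono hnonneg).map_csSup_of_continuousWithinAt (by fun_prop) hne
    hbdd).symm

end OneSubSq

theorem nonempty_of_forall_trace_eq {C D : Type*} [Fintype C] [Nonempty C] [Fintype D]
    {f : Matrix C C ℂ → Matrix D D ℂ} (hf : ∀ X, (f X).trace = X.trace) : Nonempty D := by
  classical
  by_contra! hD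
  have htrace := hf 1
  rw [Matrix.trace_one, Matrix.trace_eq_zero_of_isEmpty] at htrace
  exact Nat.cast_ne_zero.mpr Fintype.card_ne_zero htrace.symm

end QSim

open QSim in
theorem mainTheorem11_general {ι : Type*} [Fintype ι] [DecidableEq ι] {A Ah A' : ι → Type*}
    [∀ i, Fintype (A i)] [∀ i, DecidableEq (A i)] [Nonempty (∀ i, A i)]
    [∀ i, Fintype (Ah i)] [∀ i, DecidableEq (Ah i)]
    [∀ i, Fintype (A' i)] [∀ i, DecidableEq (A' i)] [Nonempty (∀ i, A' i)]
    {N : Matrix (∀ i, A i) (∀ i, A i) ℂ →ₗ[ℂ] Matrix (∀ i, A' i) (∀ i, A' i) ℂ} (hN : QSim.IsCP N)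
    {ρ : Matrix (∀ i, Ah i) (∀ i, Ah i) ℂ} (hρ : ρ.PosSemidef) :
    (QSim.simErrors N ρ).Nonempty ∧ BddBelow (QSim.simErrors N ρ) ∧
    (QSim.sdpValues N ρ).Nonempty ∧ BddAbove (QSim.sdpValues N ρ) ∧
    QSim.simErrorPPT N ρ = 1 - sSup (QSim.sdpValues N ρ) ^ 2 := by
  have hsubset := rootFidelities_subset_sdpValues hN hρ
  have hne : (rootFidelities N ρ).Nonempty := rootFidelities_nonempty
  have hbdd : BddAbove (sdpValues N ρ) := bddAbove_sdpValues
  have hsSup : sSup (rootFidelities N ρ) = sSup (sdpValues N ρ) :=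
    csSup_eq_csSup_of_forall_exists_le (fun r hr => ⟨r, hsubset hr, le_rfl⟩)
      fun l hl => exists_mem_rootFidelities_ge hN hρ hl
  have hnonneg : rootFidelities N ρ ⊆ Set.Ici 0 := fun _ => nonneg_of_mem_rootFidelities
  rw [simErrorPPT, simErrors_eq_image_rootFidelities, ← hsSup]
  exact ⟨hne.image _, bddBelow_image_one_sub_sq hne (hbdd.mono hsubset) hnonneg,
    hne.mono hsubset, hbdd, sInf_image_one_sub_sq hne (hbdd.mono hsubset) hnonneg⟩

theorem mainTheorem11 (M : ℕ) (A Ah A' : Fin M → Type*)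
    [∀ i, Fintype (A i)] [∀ i, DecidableEq (A i)] [∀ i, Nonempty (A i)]
    [∀ i, Fintype (Ah i)] [∀ i, DecidableEq (Ah i)]
    [∀ i, Fintype (A' i)] [∀ i, DecidableEq (A' i)]
    (N : Matrix (∀ i, A i) (∀ i, A i) ℂ →ₗ[ℂ] Matrix (∀ i, A' i) (∀ i, A' i) ℂ)
    (hN : QSim.IsChannel N)
    (ρ : Matrix (∀ i, Ah i) (∀ i, Ah i) ℂ) (hρ : QSim.IsState ρ) :
    (QSim.simErrors N ρ).Nonempty ∧ BddBelow (QSim.simErrors N ρ) ∧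
    (QSim.sdpValues N ρ).Nonempty ∧ BddAbove (QSim.sdpValues N ρ) ∧
    QSim.simErrorPPT N ρ = 1 - (sSup (QSim.sdpValues N ρ)) ^ 2 :=
  have := QSim.nonempty_of_forall_trace_eq hN.2
  mainTheorem11_general hN.1 hρ.1
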